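/- Let $n$ be a natural number. For a positive semidefinite (Hermitian) matrix $T\in M_n(\mathbb{C})$ and a real number $s\ge 0$, let $T^{s}$ be defined by the functional calculus, with the convention $0^0=1$ (so $T^0=I$). (i) For every natural number $m\ge 1$ and all positive semidefinite matrices $T,A\in M_n(\mathbb{C})$, the traces below are real and $$\mathrm{Tr}\left[(T^{1/m}A)^m\right]\le \mathrm{Tr}\left[TA^m\right].$$ (ii) For every $\alpha\in[0,1]$, every positive semidefinite matrix $T\in M_n(\mathbb{C})$ and every Hermitian matrix $A\in M_n(\mathbb{C})$, the traces below are real and $$\mathrm{Tr}\left[(T^{1/2}A)^2\right]\le \mathrm{Tr}\left[T^{\alpha}AT^{1-\alpha}A\right]\le \mathrm{Tr}\left[TA^2\right].$$ -/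

import Mathlib

open scoped MatrixOrder ComplexOrder

/-!
Both parts compare traces of products of powers of positive semidefinite matrices.

The first part is the Lieb–Thirring inequality `Tr (BA)^m ≤ Tr B^m A^m` for `B = T^(1/m)`. Put
`K = A^(1/2) B^(1/2)` and `P = Kᴴ K`; then `Tr (BA)^m = Tr P^m`. The entire function
`F z = Tr (P^(m - 1/2 - mz/2) Kᴴ A^(mz/2) B^(mz/2))` takes the value `Tr P^m` at `z = 1/m`. The
Cauchy–Schwarz inequality for the Frobenius norm bounds it by `Tr P^m` on `re z = 0`, where the
powers of `A` and `B` are contractions, and by `(Tr P^m)^(1/2) (Tr A^m B^m)^(1/2)` on `re z = 1`.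
Hadamard's three-line theorem at `z = 1/m` gives `Tr P^m ≤ Tr A^m B^m`; this is
`Matrix.PosSemidef.trace_conjTranspose_mul_self_pow_le`. The complex powers used are
`Matrix.IsHermitian.suppPow`, which vanish on the kernel, so singular matrices need no separate
treatment.

For the second part, let `t i` be the eigenvalues of `T`. In an eigenbasis of `T`,
`Tr (T^α A T^(1-α) A) = ∑ i j, (t i)^α (t j)^(1-α) |A i j|^2`. Symmetrising in `i` and `j` reduces
both inequalities to scalar inequalities between means,
`Matrix.rpow_mul_rpow_add_bounds`, since `α = 1/2` and `α = 1` give the outer terms.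
-/

namespace Matrix

variable {n : Type*} [Fintype n] [DecidableEq n]

/-! ### Traces -/

theorem trace_mul_pow_comm (X Y : Matrix n n ℂ) (k : ℕ) :
    ((X * Y) ^ k).trace = ((Y * X) ^ k).trace := by
  cases k with
  | zero => simp
  | succ k =>
    rw [pow_succ, ← mul_assoc, mul_pow_mul, trace_mul_comm, ← mul_assoc, ← pow_succ']

theorem trace_im_eq_zero_of_trace_conjTranspose {n : Type*} [Fintype n] {M : Matrix n n ℂ}
    (h : Mᴴ.trace = M.trace) : M.trace.im = 0 := by
  rw [trace_conjTranspose] at h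
  exact Complex.conj_eq_iff_im.1 h

/-! ### Frobenius norm and trace -/

section Frobenius

attribute [local instance] Matrix.frobeniusNormedRing Matrix.frobeniusNormedAlgebra

theorem frobenius_norm_sq_eq_trace (M : Matrix n n ℂ) : ‖M‖ ^ 2 = (M * Mᴴ).trace.re := by
  rw [frobenius_norm_def, ← Real.rpow_natCast, ← Real.rpow_mul (by positivity)]
  simp [trace, mul_apply, Complex.mul_conj, Complex.normSq_eq_norm_sq, -Complex.ofReal_pow]

/-- The Cauchy–Schwarz inequality for the Hilbert–Schmidt inner product. -/
theorem norm_trace_mul_le (X Y : Matrix n n ℂ) : ‖(X * Y).trace‖ ≤ ‖X‖ * ‖Y‖ := by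
  have h1 : ‖(X * Y).trace‖ ≤ ∑ p : n × n, ‖X p.1 p.2‖ * ‖Y p.2 p.1‖ := by
    rw [Fintype.sum_prod_type]
    simp only [trace, diag_apply, mul_apply]
    refine (norm_sum_le _ _).trans (Finset.sum_le_sum fun i _ => ?_)
    refine (norm_sum_le _ _).trans (Finset.sum_le_sum fun j _ => ?_)
    exact norm_mul_le _ _
  refine h1.trans ((Real.sum_mul_le_sqrt_mul_sqrt _ _ _).trans_eq ?_)
  congr 1
  · rw [frobenius_norm_def, Real.sqrt_eq_rpow, Fintype.sum_prod_type]
    simp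
  · rw [frobenius_norm_def, Real.sqrt_eq_rpow, Fintype.sum_prod_type, Finset.sum_comm]
    simp

end Frobenius

/-! ### Complex powers of Hermitian matrices -/

namespace IsHermitian

/-- The power `A ^ z` computed on the span of the eigenvectors of `A` with positive eigenvalue, and
extended by `0` to the orthogonal complement. In particular the purely imaginary powers are partial
isometries and the zeroth power is the projection onto that span. With this convention `z ↦ A ^ z`
is entire even when `A` is singular. -/
noncomputable def suppPow {A : Matrix n n ℂ} (hA : A.IsHermitian) (z : ℂ) : Matrix n n ℂ :=
  Unitary.conjStarAlgAut ℂ _ hA.eigenvectorUnitary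
    (diagonal fun i => if 0 < hA.eigenvalues i then (hA.eigenvalues i : ℂ) ^ z else 0)

variable {A : Matrix n n ℂ} (hA : A.IsHermitian)

theorem suppPow_mul_suppPow (z w : ℂ) : hA.suppPow z * hA.suppPow w = hA.suppPow (z + w) := by
  rw [suppPow, suppPow, ← map_mul, diagonal_mul_diagonal, suppPow]
  congr 2
  ext i
  split_ifs with h
  · rw [Complex.cpow_add _ _ (by exact_mod_cast h.ne')]
  · simp

theorem conjTranspose_suppPow (z : ℂ) :
    (hA.suppPow z)ᴴ = hA.suppPow (starRingEnd ℂ z) := by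
  rw [suppPow, ← star_eq_conjTranspose, ← map_star, star_eq_conjTranspose,
    diagonal_conjTranspose, suppPow]
  congr 2
  ext i
  simp only [Pi.star_apply]
  split_ifs with h
  · have harg : (hA.eigenvalues i : ℂ).arg ≠ Real.pi := by
      rw [Complex.arg_ofReal_of_nonneg h.le]
      exact Real.pi_pos.ne
    rw [Complex.cpow_conj _ _ harg, Complex.conj_ofReal]
    rfl
  · simp

end IsHermitian

theorem PosSemidef.suppPow_one {A : Matrix n n ℂ} (hA : A.PosSemidef) :
    hA.isHermitian.suppPow 1 = A := by
  conv_rhs => rw [hA.isHermitian.spectral_theorem]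
  rw [IsHermitian.suppPow]
  congr 2
  ext i
  have := hA.eigenvalues_nonneg i
  split_ifs with h
  · simp
  · simp [le_antisymm (not_lt.1 h) this]

theorem PosSemidef.suppPow_natCast_succ {A : Matrix n n ℂ} (hA : A.PosSemidef) (k : ℕ) :
    hA.isHermitian.suppPow (k + 1) = A ^ (k + 1) := by
  induction k with
  | zero => simp [hA.suppPow_one]
  | succ k ih =>
    have h := hA.isHermitian.suppPow_mul_suppPow (k + 1) 1
    rw [hA.suppPow_one, ih, ← pow_succ] at h
    rw [h, Nat.cast_succ]

section Frobenius

attribute [local instance] Matrix.frobeniusNormedRing Matrix.frobeniusNormedAlgebra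

namespace IsHermitian

variable {A : Matrix n n ℂ} (hA : A.IsHermitian)

theorem differentiable_suppPow : Differentiable ℂ hA.suppPow := by
  have : Differentiable ℂ fun z : ℂ =>
      (diagonal fun i => if 0 < hA.eigenvalues i then (hA.eigenvalues i : ℂ) ^ z else 0 :
        Matrix n n ℂ) := by
    -- Differentiability is clear for a sum of scalar functions times fixed matrix units.
    rw [show (fun z : ℂ =>
      (diagonal fun i => if 0 < hA.eigenvalues i then (hA.eigenvalues i : ℂ) ^ z else 0 :
        Matrix n n ℂ)) = fun z => ∑ i,
        (if 0 < hA.eigenvalues i then (hA.eigenvalues i : ℂ) ^ z else 0) • single i i (1 : ℂ) by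
        ext z a b
        rw [diagonal_apply, Matrix.sum_apply]
        simp only [smul_apply, single_apply, ite_and, smul_eq_mul, mul_ite, mul_one, mul_zero]
        simp]
    refine Differentiable.fun_sum fun i _ => ?_
    split_ifs with h
    · refine Differentiable.smul_const ?_ _
      exact fun z => (differentiableAt_id).const_cpow (Or.inl (by exact_mod_cast h.ne'))
    · simp
  unfold suppPow
  simp only [Unitary.conjStarAlgAut_apply]
  fun_prop

/-- An imaginary shift of the exponent multiplies by a partial isometry whose initial space is the
range of the power, so it does not change the Frobenius norm. -/
theorem norm_suppPow (z : ℂ) : ‖hA.suppPow z‖ = ‖hA.suppPow z.re‖ := by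
  rw [← sq_eq_sq₀ (norm_nonneg _) (norm_nonneg _), frobenius_norm_sq_eq_trace,
    frobenius_norm_sq_eq_trace, conjTranspose_suppPow, conjTranspose_suppPow,
    suppPow_mul_suppPow, suppPow_mul_suppPow, Complex.add_conj, Complex.conj_ofReal,
    ← two_mul]
  push_cast
  rfl

/-- Powers with purely imaginary exponent are contractions for the Frobenius norm. -/
theorem norm_mul_suppPow_le (X : Matrix n n ℂ) {z : ℂ} (hz : z.re = 0) :
    ‖X * hA.suppPow z‖ ≤ ‖X‖ := by
  have e0 : hA.suppPow z * (hA.suppPow z)ᴴ = hA.suppPow 0 := by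
    rw [conjTranspose_suppPow, suppPow_mul_suppPow, Complex.add_conj, hz]
    simp
  have e1 : hA.suppPow 0 * hA.suppPow 0 = hA.suppPow 0 := by
    rw [suppPow_mul_suppPow, add_zero]
  have e2 : (hA.suppPow 0)ᴴ = hA.suppPow 0 := by
    rw [conjTranspose_suppPow, map_zero]
  -- Pythagoras for the projection `hA.suppPow 0` acting on the right.
  have key : ‖X * hA.suppPow z‖ ^ 2 + ‖X * (1 - hA.suppPow 0)‖ ^ 2 = ‖X‖ ^ 2 := by
    rw [frobenius_norm_sq_eq_trace, frobenius_norm_sq_eq_trace, frobenius_norm_sq_eq_trace,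
      ← Complex.add_re, ← trace_add]
    have e3 : (1 - hA.suppPow 0) * (1 - hA.suppPow 0)ᴴ = 1 - hA.suppPow 0 := by
      rw [conjTranspose_sub, conjTranspose_one, e2, sub_mul, one_mul, mul_sub, e1]
      simp
    have e4 : X * hA.suppPow z * (X * hA.suppPow z)ᴴ = X * hA.suppPow 0 * Xᴴ := by
      rw [conjTranspose_mul, ← e0]; noncomm_ring
    have e5 : X * (1 - hA.suppPow 0) * (X * (1 - hA.suppPow 0))ᴴ
        = X * (1 - hA.suppPow 0) * Xᴴ := by
      rw [conjTranspose_mul, ← mul_assoc, mul_assoc X, e3]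
    rw [e4, e5]
    congr 2
    noncomm_ring
  refine (sq_le_sq₀ (norm_nonneg _) (norm_nonneg _)).1 ?_
  nlinarith [sq_nonneg ‖X * (1 - hA.suppPow 0)‖]

end IsHermitian

end Frobenius

/-! ### The Lieb–Thirring trace inequality -/

section Frobenius

attribute [local instance] Matrix.frobeniusNormedRing Matrix.frobeniusNormedAlgebra

/-- If `s ^ 2` is at most the interpolation at `1 / m` between `s * s` and `s * N`, then the powers
of `s` cancel to leave `s ≤ N`. -/
theorem sq_le_sq_of_sq_le_interpolation {s N m : ℝ} (hs : 0 ≤ s) (hN : 0 ≤ N) (hm : 0 < m)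
    (h : s ^ 2 ≤ (s * s) ^ (1 - 1 / m) * (s * N) ^ (1 / m)) : s ^ 2 ≤ N ^ 2 := by
  rcases hs.eq_or_lt with rfl | hspos
  · simpa using sq_nonneg N
  have hss : 0 < s * s := by positivity
  rw [Real.rpow_sub hss, Real.rpow_one, div_mul_eq_mul_div, le_div_iff₀ (by positivity), sq] at h
  have h1 : (s * s) ^ (1 / m) ≤ (s * N) ^ (1 / m) := le_of_mul_le_mul_left h hss
  have h2 : s * s ≤ s * N := (Real.rpow_le_rpow_iff hss.le (by positivity) (by positivity)).1 h1
  have h3 : s ≤ N := le_of_mul_le_mul_left h2 hspos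
  gcongr

namespace IsHermitian

variable {A B P : Matrix n n ℂ} (hA : A.IsHermitian) (hB : B.IsHermitian) (hP : P.IsHermitian)
  (L : Matrix n n ℂ) (c d : ℝ)

theorem differentiable_trace_suppPow : Differentiable ℂ fun z : ℂ =>
    (hP.suppPow (c - d * z) * L * (hA.suppPow (d * z) * hB.suppPow (d * z))).trace := by
  have da := hA.differentiable_suppPow
  have db := hB.differentiable_suppPow
  have dp := hP.differentiable_suppPow
  have : Differentiable ℂ fun z : ℂ =>
      hP.suppPow (c - d * z) * L * (hA.suppPow (d * z) * hB.suppPow (d * z)) := by fun_prop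
  exact (traceLinearMap n ℂ ℂ).toContinuousLinearMap.differentiable.comp this

theorem bddAbove_norm_trace_suppPow : BddAbove ((norm ∘ fun z : ℂ =>
    (hP.suppPow (c - d * z) * L * (hA.suppPow (d * z) * hB.suppPow (d * z))).trace) ''
      Complex.HadamardThreeLines.verticalClosedStrip 0 1) := by
  -- The norms of the factors depend only on `z.re`, which ranges over the compact `[0, 1]`.
  let G : ℝ → ℝ := fun x => ‖hP.suppPow ((c - d * x : ℝ) : ℂ)‖ * ‖L‖ *
    (‖hA.suppPow ((d * x : ℝ) : ℂ)‖ * ‖hB.suppPow ((d * x : ℝ) : ℂ)‖)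
  have hG : Continuous G := by
    have := hA.differentiable_suppPow.continuous
    have := hB.differentiable_suppPow.continuous
    have := hP.differentiable_suppPow.continuous
    fun_prop
  obtain ⟨C, hC⟩ := (isCompact_Icc (a := (0 : ℝ)) (b := 1)).bddAbove_image hG.continuousOn
  refine ⟨C, ?_⟩
  rintro _ ⟨z, hz, rfl⟩
  refine le_trans ?_ (hC ⟨z.re, hz, rfl⟩)
  refine (norm_trace_mul_le _ _).trans ?_
  have e1 := hP.norm_suppPow (c - d * z)
  have e2 := hA.norm_suppPow (d * z)
  have e3 := hB.norm_suppPow (d * z)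
  rw [show ((c : ℂ) - d * z).re = c - d * z.re by simp] at e1
  rw [show ((d : ℂ) * z).re = d * z.re by simp] at e2 e3
  simp only [G]
  rw [← e1, ← e2, ← e3]
  exact mul_le_mul (norm_mul_le _ _) (norm_mul_le _ _) (norm_nonneg _)
    (mul_nonneg (norm_nonneg _) (norm_nonneg _))

end IsHermitian

/-- The interpolation step of the Lieb–Thirring inequality. With `m = k + 1`, Hadamard's three-line
theorem is applied to
`F z = Tr (P ^ (m - 1/2 - m z / 2) * Kᴴ * A ^ (m z / 2) * B ^ (m z / 2))`,
whose value at `z = 1 / m` is `Tr P ^ m = s ^ 2`. On `re z = 0` the powers of `A` and `B` are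
contractions and `|F| ≤ s ^ 2`; on `re z = 1` one has `|F| ≤ s * N` with
`N ^ 2 = Tr (A ^ m * B ^ m)`. -/
theorem PosSemidef.trace_conjTranspose_mul_self_pow_le {A B P K : Matrix n n ℂ}
    (hA : A.PosSemidef) (hB : B.PosSemidef) (hP : P.PosSemidef)
    (hK : K = hA.isHermitian.suppPow (1 / 2) * hB.isHermitian.suppPow (1 / 2))
    (hPK : P = Kᴴ * K) (k : ℕ) :
    (P ^ (k + 1)).trace.re ≤ (A ^ (k + 1) * B ^ (k + 1)).trace.re := by
  set a := hA.isHermitian.suppPow with ha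
  set b := hB.isHermitian.suppPow with hb
  set p := hP.isHermitian.suppPow with hp
  set m : ℝ := k + 1 with hm
  have hm1 : 1 ≤ m := by simp [hm]
  have hm0 : 0 < m := by linarith
  have hmc : (m : ℂ) = k + 1 := by simp [hm]
  set s : ℝ := ‖p (m / 2)‖ with hs
  set N : ℝ := ‖a (m / 2) * b (m / 2)‖ with hN
  -- The exponent laws, restated for the abbreviations so that `rw` can use them.
  have aa : ∀ z w, a z * a w = a (z + w) := hA.isHermitian.suppPow_mul_suppPow
  have bb : ∀ z w, b z * b w = b (z + w) := hB.isHermitian.suppPow_mul_suppPow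
  have pp : ∀ z w, p z * p w = p (z + w) := hP.isHermitian.suppPow_mul_suppPow
  have ac : ∀ z, (a z)ᴴ = a (starRingEnd ℂ z) := hA.isHermitian.conjTranspose_suppPow
  have bc : ∀ z, (b z)ᴴ = b (starRingEnd ℂ z) := hB.isHermitian.conjTranspose_suppPow
  have pc : ∀ z, (p z)ᴴ = p (starRingEnd ℂ z) := hP.isHermitian.conjTranspose_suppPow
  have hs2 : s ^ 2 = (P ^ (k + 1)).trace.re := by
    rw [hs, frobenius_norm_sq_eq_trace, pc, pp, ← hP.suppPow_natCast_succ, ← hmc,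
      Complex.add_conj]
    simp [← hp, mul_div_cancel₀]
  have hp1 : p 1 = Kᴴ * K := by rw [← hPK]; exact hP.suppPow_one
  have hpK : ∀ z : ℂ, z.re = (m - 1) / 2 → ‖p z * Kᴴ‖ = s := by
    intro z hz
    rw [← sq_eq_sq₀ (norm_nonneg _) (norm_nonneg _), hs2, frobenius_norm_sq_eq_trace,
      conjTranspose_mul, conjTranspose_conjTranspose, pc, mul_assoc, ← mul_assoc Kᴴ, ← hp1,
      pp, pp, ← hP.suppPow_natCast_succ, ← hmc]
    congr 3
    rw [add_left_comm, Complex.add_conj, hz]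
    push_cast
    ring
  have hab : ∀ z : ℂ, z.re = m / 2 → ‖a z * b z‖ ^ 2 = (A ^ (k + 1) * B ^ (k + 1)).trace.re := by
    intro z hz
    rw [frobenius_norm_sq_eq_trace, conjTranspose_mul, ac, bc, mul_assoc, ← mul_assoc (b z), bb,
      ← mul_assoc, trace_mul_cycle, aa, add_comm _ z, Complex.add_conj, hz,
      ← hA.suppPow_natCast_succ, ← hB.suppPow_natCast_succ, ← hmc]
    simp [← ha, ← hb, mul_div_cancel₀]
  have hN2 : N ^ 2 = (A ^ (k + 1) * B ^ (k + 1)).trace.re := hab _ (by simp)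
  have hN' : ∀ z : ℂ, z.re = m / 2 → ‖a z * b z‖ = N := fun z hz => by
    rw [← sq_eq_sq₀ (norm_nonneg _) (norm_nonneg _), hN2, hab z hz]
  let F : ℂ → ℂ := fun z =>
    (p ((m - 1 / 2 : ℝ) - (m / 2 : ℝ) * z) * Kᴴ *
      (a ((m / 2 : ℝ) * z) * b ((m / 2 : ℝ) * z))).trace
  have hFz : ∀ z, F z = (p (m - 1 / 2 - m / 2 * z) * Kᴴ *
      (a (m / 2 * z) * b (m / 2 * z))).trace := fun z => by
    simp only [F]
    push_cast
    rfl
  have hF : Differentiable ℂ F := IsHermitian.differentiable_trace_suppPow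
    hA.isHermitian hB.isHermitian hP.isHermitian Kᴴ (m - 1 / 2) (m / 2)
  have hbdd := IsHermitian.bddAbove_norm_trace_suppPow
    hA.isHermitian hB.isHermitian hP.isHermitian Kᴴ (m - 1 / 2) (m / 2)
  have h0 : ∀ z ∈ Complex.re ⁻¹' {0}, ‖F z‖ ≤ s * s := by
    intro z hz
    have hz : z.re = 0 := hz
    -- Splitting off half of the real exponent of `P` balances the two Cauchy–Schwarz factors.
    have : F z = (p (m / 2) * (p ((m - 1) / 2 - m / 2 * z) * Kᴴ * a (m / 2 * z)
        * b (m / 2 * z))).trace := by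
      simp only [hFz, ← mul_assoc, pp]
      congr 5
      ring
    rw [this]
    refine (norm_trace_mul_le _ _).trans ?_
    refine mul_le_mul_of_nonneg_left ?_ (norm_nonneg _)
    refine (hB.isHermitian.norm_mul_suppPow_le _ (by simp [hz])).trans ?_
    refine (hA.isHermitian.norm_mul_suppPow_le _ (by simp [hz])).trans ?_
    exact (hpK _ (by simp [hz])).le
  have h1 : ∀ z ∈ Complex.re ⁻¹' {1}, ‖F z‖ ≤ s * N := by
    intro z hz
    have hz : z.re = 1 := hz
    rw [hFz]
    refine (norm_trace_mul_le _ _).trans ?_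
    rw [hpK _ (by simp [hz]; ring), hN' _ (by simp [hz])]
  have hmain := Complex.HadamardThreeLines.norm_le_interp_of_mem_verticalClosedStrip₀₁' F
    (z := ((1 / m : ℝ) : ℂ)) ⟨by simp; positivity, by simpa using inv_le_one_of_one_le₀ hm1⟩
    hF.diffContOnCl hbdd h0 h1
  have hFm : F ((1 / m : ℝ) : ℂ) = (P ^ (k + 1)).trace := by
    have hmc0 : (m : ℂ) ≠ 0 := by exact_mod_cast hm0.ne'
    have e : (m : ℂ) / 2 * ((1 / m : ℝ) : ℂ) = 1 / 2 := by push_cast; field_simp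
    simp only [hFz, e]
    rw [← hK, mul_assoc, ← hp1, pp, ← hP.suppPow_natCast_succ, ← hmc]
    congr 2
    ring
  rw [hFm] at hmain
  have hs0 : 0 ≤ s := norm_nonneg _
  have hN0 : 0 ≤ N := norm_nonneg _
  have hmain2 : s ^ 2 ≤ (s * s) ^ (1 - 1 / m) * (s * N) ^ (1 / m) := by
    rw [hs2]
    refine (Complex.re_le_norm _).trans ?_
    simpa using hmain
  rw [← hs2, ← hN2]
  exact sq_le_sq_of_sq_le_interpolation hs0 hN0 hm0 hmain2

end Frobenius

/-- The **Lieb–Thirring inequality** for natural exponents: `Tr (BA)^m ≤ Tr B^m A^m`. -/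
theorem PosSemidef.trace_mul_pow_le {A B : Matrix n n ℂ} (hA : A.PosSemidef)
    (hB : B.PosSemidef) {m : ℕ} (hm : m ≠ 0) : ((B * A) ^ m).trace.re ≤ (B ^ m * A ^ m).trace.re := by
  obtain ⟨k, rfl⟩ := Nat.exists_eq_succ_of_ne_zero hm
  set a := hA.isHermitian.suppPow (1 / 2) with ha
  set b := hB.isHermitian.suppPow (1 / 2) with hb
  have haa : a * a = A := by
    rw [ha, IsHermitian.suppPow_mul_suppPow, add_halves, hA.suppPow_one]
  have hbb : b * b = B := by
    rw [hb, IsHermitian.suppPow_mul_suppPow, add_halves, hB.suppPow_one]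
  have hhalf : starRingEnd ℂ (1 / 2) = 1 / 2 := by
    simpa using Complex.conj_ofReal (1 / 2)
  have hah : aᴴ = a := by rw [ha, IsHermitian.conjTranspose_suppPow, hhalf]
  have hbh : bᴴ = b := by rw [hb, IsHermitian.conjTranspose_suppPow, hhalf]
  have hP : (a * b)ᴴ * (a * b) = b * (A * b) := by
    rw [conjTranspose_mul, hah, hbh, ← haa]; noncomm_ring
  have hBA : B * A = b * (b * A) := by rw [← mul_assoc, hbb]
  have h := PosSemidef.trace_conjTranspose_mul_self_pow_le hA hB
    (posSemidef_conjTranspose_mul_self (a * b)) rfl rfl k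
  rw [hP, ← mul_assoc, trace_mul_comm (A ^ _)] at h
  rwa [hBA, trace_mul_pow_comm]

/-! ### Real powers in an eigenbasis -/

theorem PosSemidef.rpow_eq {T : Matrix n n ℂ} (hT : T.PosSemidef) (α : ℝ) :
    T ^ α = Unitary.conjStarAlgAut ℂ _ hT.isHermitian.eigenvectorUnitary
      (diagonal fun i => ((hT.isHermitian.eigenvalues i ^ α : ℝ) : ℂ)) := by
  rw [CFC.rpow_eq_cfc_real hT.nonneg, hT.isHermitian.cfc_eq]
  rfl

theorem PosSemidef.rpow_one_div_pow {T : Matrix n n ℂ} (hT : T.PosSemidef) {m : ℕ} (hm : m ≠ 0) :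
    (T ^ (1 / (m : ℝ))) ^ m = T := by
  rw [hT.rpow_eq, ← map_pow, diagonal_pow]
  conv_rhs => rw [hT.isHermitian.spectral_theorem]
  congr 2
  ext i
  rw [Pi.pow_apply, ← Complex.ofReal_pow, ← Real.rpow_natCast,
    ← Real.rpow_mul (hT.eigenvalues_nonneg i), one_div, inv_mul_cancel₀ (by exact_mod_cast hm),
    Real.rpow_one]
  rfl

/-! ### Interpolated traces of a Hermitian matrix -/

/-- The expansion of the trace in an eigenbasis of `T`: the numbers `t i` are the eigenvalues, and
the weights are `w i j = |A i j| ^ 2`. -/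
theorem PosSemidef.exists_trace_rpow_mul_eq_sum {T A : Matrix n n ℂ} (hT : T.PosSemidef)
    (hA : A.IsHermitian) :
    ∃ t : n → ℝ, ∃ w : n → n → ℝ, (∀ i, 0 ≤ t i) ∧ (∀ i j, 0 ≤ w i j) ∧ (∀ i j, w i j = w j i) ∧
      ∀ α β : ℝ, (T ^ α * A * T ^ β * A).trace =
        ((∑ i, ∑ j, t i ^ α * t j ^ β * w i j : ℝ) : ℂ) := by
  set φ := Unitary.conjStarAlgAut ℂ _ hT.isHermitian.eigenvectorUnitary with hφ
  set C := φ.symm A with hC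
  have hCA : A = φ C := by simp [hC]
  have hCH : C.IsHermitian := by
    rw [hC, IsHermitian, ← star_eq_conjTranspose, ← map_star, star_eq_conjTranspose, hA.eq]
  have htr : ∀ M, (φ M).trace = M.trace := fun M => by
    rw [hφ, Unitary.conjStarAlgAut_apply, trace_mul_cycle, Unitary.coe_star_mul_self, one_mul]
  refine ⟨hT.isHermitian.eigenvalues, fun i j => ‖C i j‖ ^ 2, hT.eigenvalues_nonneg,
    fun i j => by positivity, fun i j => ?_, fun α β => ?_⟩
  · simp only [← hCH.apply i j, norm_star]
  · rw [hT.rpow_eq, hT.rpow_eq, ← hφ, hCA, ← map_mul, ← map_mul, ← map_mul, htr, mul_assoc]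
    simp only [trace, diag_apply, Complex.ofReal_sum]
    refine Finset.sum_congr rfl fun i _ => ?_
    rw [mul_apply]
    refine Finset.sum_congr rfl fun j _ => ?_
    rw [diagonal_mul, diagonal_mul]
    have : C j i = starRingEnd ℂ (C i j) := (hCH.apply j i).symm
    rw [this]
    push_cast
    rw [← Complex.mul_conj']
    ring

/-- The two summands `a ^ α * b ^ (1 - α)` and `b ^ α * a ^ (1 - α)` have product `a * b` for every
`α ∈ [0, 1]`, so the lower bound is the inequality of arithmetic and geometric means; the upper bound is the
weighted form of the same inequality. -/
theorem rpow_mul_rpow_add_bounds {a b α : ℝ} (ha : 0 ≤ a) (hb : 0 ≤ b)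
    (hα : α ∈ Set.Icc (0 : ℝ) 1) :
    a ^ (1 / 2 : ℝ) * b ^ (1 / 2 : ℝ) + b ^ (1 / 2 : ℝ) * a ^ (1 / 2 : ℝ) ≤
        a ^ α * b ^ (1 - α) + b ^ α * a ^ (1 - α) ∧
      a ^ α * b ^ (1 - α) + b ^ α * a ^ (1 - α) ≤ a + b := by
  obtain ⟨h0, h1⟩ := hα
  have h1' : 0 ≤ 1 - α := by linarith
  constructor
  · have hsq : ∀ {x : ℝ}, 0 ≤ x → x ^ α * x ^ (1 - α) = x ^ (1 / 2 : ℝ) * x ^ (1 / 2 : ℝ) :=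
      fun {x} hx => by
        rw [← Real.rpow_add_of_nonneg hx h0 h1', ← Real.rpow_add_of_nonneg hx (by norm_num)
          (by norm_num)]
        norm_num
    have hxy : (a ^ α * b ^ (1 - α)) * (b ^ α * a ^ (1 - α)) =
        (a ^ (1 / 2 : ℝ) * b ^ (1 / 2 : ℝ)) ^ 2 := by
      calc _ = (a ^ α * a ^ (1 - α)) * (b ^ α * b ^ (1 - α)) := by ring
        _ = _ := by rw [hsq ha, hsq hb]; ring
    have hx : 0 ≤ a ^ α * b ^ (1 - α) := by positivity
    have hy : 0 ≤ b ^ α * a ^ (1 - α) := by positivity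
    refine (sq_le_sq₀ (by positivity) (by positivity)).1 ?_
    nlinarith [sq_nonneg (a ^ α * b ^ (1 - α) - b ^ α * a ^ (1 - α))]
  · have e1 := Real.geom_mean_le_arith_mean2_weighted h0 h1' ha hb (by ring)
    have e2 := Real.geom_mean_le_arith_mean2_weighted h0 h1' hb ha (by ring)
    linarith

theorem PosSemidef.trace_rpow_bounds {T A : Matrix n n ℂ} (hT : T.PosSemidef) (hA : A.IsHermitian)
    {α : ℝ} (hα : α ∈ Set.Icc (0 : ℝ) 1) :
      (((T ^ (1 / 2 : ℝ) * A) ^ 2).trace.im = 0 ∧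
        (T ^ α * A * T ^ (1 - α) * A).trace.im = 0 ∧ (T * A ^ 2).trace.im = 0) ∧
      ((T ^ (1 / 2 : ℝ) * A) ^ 2).trace.re ≤ (T ^ α * A * T ^ (1 - α) * A).trace.re ∧
      (T ^ α * A * T ^ (1 - α) * A).trace.re ≤ (T * A ^ 2).trace.re := by
  obtain ⟨t, w, ht, hw, hsymm, key⟩ := hT.exists_trace_rpow_mul_eq_sum hA
  have e1 : (T ^ (1 / 2 : ℝ) * A) ^ 2 = T ^ (1 / 2 : ℝ) * A * T ^ (1 / 2 : ℝ) * A := by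
    rw [sq, ← mul_assoc]
  -- `T ^ 0 = 1` also for singular `T`, so the right-hand trace is the case `α = 1`.
  have e2 : T * A ^ 2 = T ^ (1 : ℝ) * A * T ^ (0 : ℝ) * A := by
    rw [CFC.rpow_one T hT.nonneg, CFC.rpow_zero T hT.nonneg, mul_one, sq, mul_assoc]
  rw [e1, e2, key, key, key]
  simp only [Complex.ofReal_im, Complex.ofReal_re, true_and]
  -- The symmetry of the weights allows the coefficients to be symmetrised.
  have symm2 : ∀ β γ : ℝ, ∑ i, ∑ j, t i ^ β * t j ^ γ * w i j =
      2⁻¹ * ∑ i, ∑ j, (t i ^ β * t j ^ γ + t j ^ β * t i ^ γ) * w i j := by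
    intro β γ
    have : ∑ i, ∑ j, t i ^ β * t j ^ γ * w i j = ∑ i, ∑ j, t j ^ β * t i ^ γ * w i j := by
      rw [Finset.sum_comm]
      exact Finset.sum_congr rfl fun i _ => Finset.sum_congr rfl fun j _ => by rw [hsymm]
    simp only [add_mul, Finset.sum_add_distrib]
    rw [← this]
    ring
  rw [symm2, symm2 α, symm2 1]
  constructor
  · refine mul_le_mul_of_nonneg_left (Finset.sum_le_sum fun i _ => Finset.sum_le_sum fun j _ =>
      mul_le_mul_of_nonneg_right ?_ (hw i j)) (by norm_num)
    convert (rpow_mul_rpow_add_bounds (ht i) (ht j) hα).1 using 1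
  · refine mul_le_mul_of_nonneg_left (Finset.sum_le_sum fun i _ => Finset.sum_le_sum fun j _ =>
      mul_le_mul_of_nonneg_right ?_ (hw i j)) (by norm_num)
    simpa using (rpow_mul_rpow_add_bounds (ht i) (ht j) hα).2

end Matrix

theorem mainTheorem2 (n : ℕ) :
    (∀ m : ℕ, 1 ≤ m → ∀ T A : Matrix (Fin n) (Fin n) ℂ, T.PosSemidef → A.PosSemidef →
      (((T ^ (1 / (m : ℝ)) * A) ^ m).trace.im = 0 ∧ (T * A ^ m).trace.im = 0) ∧
      ((T ^ (1 / (m : ℝ)) * A) ^ m).trace.re ≤ (T * A ^ m).trace.re) ∧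
    (∀ α : ℝ, α ∈ Set.Icc (0 : ℝ) 1 → ∀ T A : Matrix (Fin n) (Fin n) ℂ,
      T.PosSemidef → A.IsHermitian →
      (((T ^ (1 / 2 : ℝ) * A) ^ 2).trace.im = 0 ∧
        (T ^ α * A * T ^ (1 - α) * A).trace.im = 0 ∧ (T * A ^ 2).trace.im = 0) ∧
      ((T ^ (1 / 2 : ℝ) * A) ^ 2).trace.re ≤ (T ^ α * A * T ^ (1 - α) * A).trace.re ∧
      (T ^ α * A * T ^ (1 - α) * A).trace.re ≤ (T * A ^ 2).trace.re) := by
  refine ⟨fun m hm T A hT hA => ?_, fun α hα T A hT hA => hT.trace_rpow_bounds hA hα⟩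
  have hB : (T ^ (1 / (m : ℝ))).PosSemidef := Matrix.nonneg_iff_posSemidef.1 CFC.rpow_nonneg
  have hm0 : m ≠ 0 := Nat.one_le_iff_ne_zero.1 hm
  refine ⟨⟨Matrix.trace_im_eq_zero_of_trace_conjTranspose ?_,
    Matrix.trace_im_eq_zero_of_trace_conjTranspose ?_⟩, ?_⟩
  · rw [Matrix.conjTranspose_pow, Matrix.conjTranspose_mul, hA.isHermitian.eq, hB.isHermitian.eq,
      Matrix.trace_mul_pow_comm]
  · rw [Matrix.conjTranspose_mul, Matrix.conjTranspose_pow, hA.isHermitian.eq, hT.isHermitian.eq,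
      Matrix.trace_mul_comm]
  · conv_rhs => rw [← hT.rpow_one_div_pow hm0]
    exact hA.trace_mul_pow_le hB hm0
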